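/- Let $\lambda$ be a Young diagram with $N$ boxes. A \emph{row-standard filling} of $\lambda$ assigns positive integers to its boxes, skipping no integer, so that the entries strictly increase from left to right in every row. Two entries $i<j$ of the same column of such a filling $\tau$ form an \emph{inversion pair} if, writing $i_k$ and $j_k$ for the entries $k$ boxes to the right of $i$ and $j$, there is an $m\ge 0$ such that $i_k$ and $j_k$ exist and $i_k=j_k$ for $1\le k\le m$, and either (a) at least one of $i_{m+1},j_{m+1}$ does not exist and $i$ appears below $j$, or (b) both exist and $i_{m+1}>j_{m+1}$. Inversion pairs in different places are counted separately. Let $S_k(\lambda)$ be the set of $k$-inverted standard Young tableaux of shape $\lambda$: the row-standard fillings of $\lambda$ without repeated entries (so with entries $1,\dots,N$, each once) that have exactly $k$ inversion pairs. Put $[m]_q=1+q+\dots+q^{m-1}$ and $[m]_q!=[1]_q[2]_q\cdots[m]_q$. **Theorem.** Let $n\ge 1$ and let $\lambda=2^n$ be the rectangular shape with $n$ rows of length $2$. Then $$\sum_{k\ge 0} |S_k(\lambda)|\,q^k \;=\; [n]_q!\,\sum_{\alpha_0+\dots+\alpha_{n-1}=n}\ \prod_{i=1}^{n-1}\binom{\alpha_i+\alpha_{i-1}-1}{\alpha_i}[i+1]_q^{\alpha_i},$$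 where the sum is over all $n$-tuples $(\alpha_0,\dots,\alpha_{n-1})$ of non-negative integers with sum $n$, and $\binom{-1}{0}=1$. -/

import Mathlib

namespace InvertedTableaux

/-- A row-standard filling of the Young diagram `μ`: positive integers in the cells of `μ`, strictly
increasing from left to right along each row, such that no positive integer is skipped. Cells are
`(row, column)`, numbered from `0`, and `entry` is `0` outside `μ`. -/
@[ext]
structure RowStandardFilling (μ : YoungDiagram) where
  entry : ℕ → ℕ → ℕ
  zeros : ∀ r c, (r, c) ∉ μ → entry r c = 0
  pos : ∀ r c, (r, c) ∈ μ → 0 < entry r c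
  row_strict : ∀ r c₁ c₂, c₁ < c₂ → (r, c₂) ∈ μ → entry r c₁ < entry r c₂
  no_skip : ∀ r c, (r, c) ∈ μ → ∀ v, 0 < v → v ≤ entry r c →
    ∃ r' c', (r', c') ∈ μ ∧ entry r' c' = v

variable {μ : YoungDiagram}

/-- The entries in the cells `(r, c)` and `(s, c)` form an inversion pair `(i, j)` of `τ`, with `i`
in row `r` and `j` in row `s`: `i < j`, and for some `m`, the entries `k` boxes to the right of `i`
and of `j` exist and are equal for `1 ≤ k ≤ m`, whereas `m + 1` boxes to the right either one of
the two boxes does not exist and `i` appears below `j`, or both exist and the entry to the right of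
`i` is the larger one. -/
def RowStandardFilling.IsInversion (τ : RowStandardFilling μ) (r s c : ℕ) : Prop :=
  (r, c) ∈ μ ∧ (s, c) ∈ μ ∧ τ.entry r c < τ.entry s c ∧
    ∃ m : ℕ,
      (∀ k, 1 ≤ k → k ≤ m →
        (r, c + k) ∈ μ ∧ (s, c + k) ∈ μ ∧ τ.entry r (c + k) = τ.entry s (c + k)) ∧
      ((((r, c + (m + 1)) ∉ μ ∨ (s, c + (m + 1)) ∉ μ) ∧ s < r) ∨
        ((r, c + (m + 1)) ∈ μ ∧ (s, c + (m + 1)) ∈ μ ∧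
          τ.entry s (c + (m + 1)) < τ.entry r (c + (m + 1))))

/-- The number of inversion pairs, where pairs in different places count separately. -/
noncomputable def RowStandardFilling.inv (τ : RowStandardFilling μ) : ℕ :=
  {p : ℕ × ℕ × ℕ | τ.IsInversion p.1 p.2.1 p.2.2}.ncard

/-- The filling has no repeated entries. -/
def RowStandardFilling.NoRepeats (τ : RowStandardFilling μ) : Prop :=
  ∀ r c r' c', (r, c) ∈ μ → (r', c') ∈ μ → τ.entry r c = τ.entry r' c' → r = r' ∧ c = c'

/-- The set `S_k(μ)` of `k`-inverted standard Young tableaux of shape `μ`. -/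
def invertedSYT (μ : YoungDiagram) (k : ℕ) : Set (RowStandardFilling μ) :=
  {τ | τ.NoRepeats ∧ τ.inv = k}

/-- The set of inversion pairs is finite, so that `inv` counts it. -/
theorem RowStandardFilling.finite_inversions (τ : RowStandardFilling μ) :
    {p : ℕ × ℕ × ℕ | τ.IsInversion p.1 p.2.1 p.2.2}.Finite := by
  refine Set.Finite.subset
    ((μ.cells ×ˢ μ.cells).image fun q => (q.1.1, q.2.1, q.1.2)).finite_toSet ?_
  rintro ⟨r, s, c⟩ ⟨hr, hs, -⟩
  simp only [Finset.coe_image, Set.mem_image, Finset.mem_coe, Finset.mem_product]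
  exact ⟨((r, c), (s, c)), ⟨hr, hs⟩, rfl⟩

theorem RowStandardFilling.entry_le (τ : RowStandardFilling μ) (r c : ℕ) :
    τ.entry r c ≤ μ.card := by
  by_cases h : (r, c) ∈ μ
  · have hsub : Finset.Icc 1 (τ.entry r c) ⊆ μ.cells.image fun x => τ.entry x.1 x.2 := by
      intro v hv
      rw [Finset.mem_Icc] at hv
      obtain ⟨r', c', h', he⟩ := τ.no_skip r c h v hv.1 hv.2
      exact Finset.mem_image.2 ⟨(r', c'), h', he⟩
    have := (Finset.card_le_card hsub).trans Finset.card_image_le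
    simpa using this
  · simp [τ.zeros r c h]

/-- There are finitely many row-standard fillings, so that `Set.ncard` counts `S_k(μ)`. -/
instance : Finite (RowStandardFilling μ) := by
  let f : RowStandardFilling μ → (μ.cells → Fin (μ.card + 1)) :=
    fun τ x => ⟨τ.entry x.1.1 x.1.2, Nat.lt_succ_of_le (τ.entry_le _ _)⟩
  refine Finite.of_injective f fun τ σ h => ?_
  ext r c
  by_cases hx : (r, c) ∈ μ
  · exact congrArg Fin.val (congrFun h ⟨(r, c), hx⟩)
  · rw [τ.zeros r c hx, σ.zeros r c hx]

/-- The shape `2^n`: `n` rows of length `2`. -/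
def twoColumnShape (n : ℕ) : YoungDiagram :=
  YoungDiagram.ofRowLens (List.replicate n 2) <| by
    rw [List.sortedGE_iff_pairwise]
    exact List.pairwise_replicate.2 (Or.inr le_rfl)

/-- The `q`-integer `[n]_q = 1 + q + ⋯ + q^(n-1)`. -/
noncomputable def qInt (n : ℕ) : Polynomial ℕ :=
  ∑ i ∈ Finset.range n, Polynomial.X ^ i

/-- The `q`-factorial `[n]_q! = [1]_q [2]_q ⋯ [n]_q`. -/
noncomputable def qFactorial (n : ℕ) : Polynomial ℕ :=
  ∏ i ∈ Finset.Icc 1 n, qInt i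

end InvertedTableaux

namespace InvertedTableaux

open Polynomial Finset

/-! Place the values `2n, …, 1` in decreasing order, counting each inversion pair when its larger
entry is placed. With `u` empty rows and `h` rows lacking only their first box, the next value goes
to the second box of one of the former or the first box of one of the latter. Over the candidate
rows, the number of new pairs runs once through `0, …, u - 1` or `0, …, h - 1`. Hence the generating
function satisfies `W(u, h) = [u] W(u-1, h+1) + [h] W(u, h-1)` (`exists_finset_isConfig`).

Dividing by `[u]! [h]!` leaves lattice paths from height `h` down to `0` with `u` up-steps, an
up-step from height `i` having weight `[i+1]`. If `α i` up-steps leave height `i`, they start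
excursions distributed, with repetition, among the `α (i-1)` arrivals from below, so `multichoose (α
(i-1)) (α i)` counts the choices at height `i`. `levelSum` is this count for an arbitrary starting
height, and `levelSum_succ` checks the recursion. -/

/-! ### `q`-integers and `q`-factorials. -/

theorem qInt_zero : qInt 0 = 0 := by simp [qInt]

theorem qInt_one : qInt 1 = 1 := by simp [qInt]

theorem qInt_succ (n : ℕ) : qInt (n + 1) = X * qInt n + 1 := by
  simp only [qInt, Finset.sum_range_succ', Finset.mul_sum, pow_succ', pow_zero]

theorem qFactorial_zero : qFactorial 0 = 1 := by simp [qFactorial]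

theorem qFactorial_succ (n : ℕ) : qFactorial (n + 1) = qFactorial n * qInt (n + 1) := by
  rw [qFactorial, qFactorial, Finset.prod_Icc_succ_top (by omega)]

/-- Summing `X ^ (number of larger elements)` over a finite set gives the `q`-integer of its
cardinality. -/
theorem sum_X_pow_card_larger {ι : Type*} [DecidableEq ι] (s : Finset ι) (f : ι → ℕ)
    (hf : Set.InjOn f s) :
    ∑ x ∈ s, (X : ℕ[X]) ^ #{y ∈ s | f x < f y} = qInt #s := by
  induction s using Finset.induction_on_max_value f with
  | empty => simp [qInt_zero]
  | insert a s ha hmax ih =>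
    have hlt : ∀ x ∈ s, f x < f a := fun x hx =>
      lt_of_le_of_ne (hmax x hx) fun h => ha (by
        rwa [← hf (by simp [hx]) (by simp) h])
    rw [Finset.sum_insert ha, Finset.card_insert_of_notMem ha, qInt_succ, add_comm,
      ← ih (hf.mono (by simp)), Finset.mul_sum]
    congr 1
    · refine Finset.sum_congr rfl fun x hx => ?_
      rw [Finset.filter_insert, if_pos (hlt x hx), Finset.card_insert_of_notMem (by simp [ha]),
        pow_succ']
    · rw [Finset.filter_eq_empty_iff.2, Finset.card_empty, pow_zero]
      intro y hy
      rcases Finset.mem_insert.1 hy with rfl | hy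
      · exact lt_irrefl _
      · exact (hlt y hy).not_gt

/-! ### Weighted lattice paths sorted by level. -/

/-- Nested sum over `L` consecutive levels starting at level `i`; the first `j` levels get one
additional arrival. `a` is the number of steps arriving at the first level and `m` the number of
steps to be distributed. -/
noncomputable def levelSum : ℕ → ℕ → ℕ → ℕ → ℕ → ℕ[X]
  | 0, _, _, _, m => if m = 0 then 1 else 0
  | L + 1, 0, i, a, m => ∑ p ∈ antidiagonal m,
      C (Nat.multichoose a p.1) * qInt (i + 1) ^ p.1 * levelSum L 0 (i + 1) p.1 p.2
  | L + 1, j + 1, i, a, m => ∑ p ∈ antidiagonal m,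
      C (Nat.multichoose (a + 1) p.1) * qInt (i + 1) ^ p.1 * levelSum L j (i + 1) p.1 p.2

theorem levelSum_total_zero (L j i a : ℕ) : levelSum L j i a 0 = 1 := by
  induction L generalizing j i a with
  | zero => simp [levelSum]
  | succ L ih => cases j <;> simp [levelSum, ih]

/-- A level without arrivals emits no up-steps, so nothing reaches the next level either. -/
theorem levelSum_arrivals_zero (L i m : ℕ) : levelSum L 0 i 0 (m + 1) = 0 := by
  induction L generalizing i m with
  | zero => simp [levelSum]
  | succ L ih =>
    simp [levelSum, Finset.Nat.sum_antidiagonal_succ, ih, Nat.multichoose_zero_succ]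

theorem levelSum_arrivals_succ (L i a m : ℕ) :
    levelSum L 0 i (a + 1) m = levelSum L 1 i a m := by
  cases L <;> simp [levelSum]

/-- First-step decomposition of a path at height `i + j`: a down-step uses up the additional arrival
at this level; an up-step gives one to the level above. At `j = 0` this is Pascal's rule for
`multichoose`; lower levels carry the identity along. -/
theorem levelSum_succ (L j i a m : ℕ) (hL : j + 1 ≤ L) :
    levelSum L (j + 1) i a (m + 1) =
      levelSum L j i a (m + 1) + qInt (i + j + 1) * levelSum L (j + 2) i a m := by
  induction j generalizing L i a m with
  | zero =>
    obtain ⟨L, rfl⟩ := Nat.exists_eq_add_of_le' hL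
    simp only [levelSum, Finset.Nat.sum_antidiagonal_succ, Nat.multichoose_succ_succ, map_add,
      add_mul, Finset.sum_add_distrib, Nat.multichoose_zero_right, levelSum_arrivals_succ,
      Finset.mul_sum, add_assoc]
    congr 2
    refine Finset.sum_congr rfl fun p _ => ?_
    simp only [zero_add]
    ring
  | succ j ih =>
    obtain ⟨L, rfl⟩ : ∃ L', L = L' + 1 := ⟨L - 1, by omega⟩
    -- The term with nothing left for higher levels is the same in both level sums of total `m + 1`;
    -- the induction hypothesis covers the others.
    simp only [levelSum, Finset.Nat.sum_antidiagonal_succ', levelSum_total_zero]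
    simp only [ih L _ _ _ (show j + 1 ≤ L by omega), mul_add, Finset.sum_add_distrib, Finset.mul_sum]
    rw [← add_assoc]
    refine congrArg₂ (· + ·) rfl (Finset.sum_congr rfl fun p _ => ?_)
    rw [show i + 1 + j + 1 = i + (j + 1) + 1 by ring]
    ring

theorem levelSum_zero_eq_sum_piAntidiag (L i a m : ℕ) :
    levelSum L 0 i a m = ∑ α ∈ Finset.piAntidiag (Finset.Ico i (i + L)) m,
      ∏ j ∈ Finset.Ico i (i + L),
        C (Nat.multichoose (if j = i then a else α (j - 1)) (α j)) * qInt (j + 1) ^ α j := by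
  induction L generalizing i a m with
  | zero =>
    rcases m with _ | m <;> simp [levelSum]
  | succ L ih =>
    have hi : i ∉ Finset.Ico (i + 1) (i + 1 + L) := by simp
    have hI : Finset.Ico i (i + (L + 1)) = Finset.cons i (Finset.Ico (i + 1) (i + 1 + L)) hi := by
      ext x; simp; omega
    rw [hI, Finset.piAntidiag_cons, Finset.sum_disjiUnion, levelSum]
    refine Finset.sum_congr rfl fun p _ => ?_
    rw [Finset.sum_map, ih, Finset.mul_sum]
    refine Finset.sum_congr rfl fun α hα => ?_
    have hαi : α i = 0 := by
      by_contra h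
      exact hi ((Finset.mem_piAntidiag.1 hα).2 i h)
    rw [Finset.prod_cons]
    congr 1
    · simp [hαi]
    · refine Finset.prod_congr rfl fun j hj => ?_
      have hj' : i + 1 ≤ j := (Finset.mem_Ico.1 hj).1
      have h1 : j ≠ i := by omega
      by_cases h : j = i + 1
      · subst h; simp [hαi]
      · have h2 : j - 1 ≠ i := by omega
        simp [h, h1, h2]

/-! ### The closed form and its recursion. -/

/-- The closed form of the generating function of the partial configurations with `u` empty rows
and `h` rows of which only the first box is empty. -/
noncomputable def configWeight (L u h : ℕ) : ℕ[X] :=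
  qFactorial u * qFactorial h * levelSum L (h + 1) 0 0 u

theorem configWeight_zero_zero (L : ℕ) : configWeight L 0 0 = 1 := by
  simp [configWeight, qFactorial_zero, levelSum_total_zero]

theorem configWeight_rec (L u h : ℕ) (hL : u + h ≤ L) (hpos : u + h ≠ 0) :
    configWeight L u h = qInt u * configWeight L (u - 1) (h + 1) +
      qInt h * configWeight L u (h - 1) := by
  rcases u with _ | u
  · obtain ⟨h, rfl⟩ : ∃ h', h = h' + 1 := ⟨h - 1, by omega⟩
    simp only [configWeight, levelSum_total_zero, qInt_zero, qFactorial_succ, Nat.add_sub_cancel]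
    ring
  · have key := levelSum_succ L h 0 0 u (by omega)
    rcases h with _ | h
    · rw [levelSum_arrivals_zero] at key
      simp only [configWeight, key, qInt_zero, qFactorial_succ, Nat.add_sub_cancel, zero_add]
      ring
    · simp only [configWeight, key, qFactorial_succ, Nat.add_sub_cancel, zero_add]
      ring

theorem configWeight_eq (n : ℕ) (hn : 1 ≤ n) :
    configWeight n n 0 = qFactorial n * ∑ α ∈ Finset.piAntidiag (Finset.range n) n,
      ∏ i ∈ Finset.Icc 1 (n - 1),
        (C (Nat.choose (α i + α (i - 1) - 1) (α i)) * qInt (i + 1) ^ α i) := by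
  rw [configWeight, qFactorial_zero, mul_one, zero_add, ← levelSum_arrivals_succ,
    levelSum_zero_eq_sum_piAntidiag, zero_add, ← Finset.range_eq_Ico]
  congr 1
  refine Finset.sum_congr rfl fun α _ => ?_
  obtain ⟨n, rfl⟩ := Nat.exists_eq_add_of_le' hn
  have hI : Finset.range (n + 1) = insert 0 (Finset.Icc 1 n) := by
    ext x; simp; omega
  -- Level `0` has a single arrival and weight `[1]`, so its factor is `1`.
  rw [hI, Finset.prod_insert (by simp), Nat.add_sub_cancel]
  simp only [if_true, zero_add, Nat.multichoose_one, map_one, qInt_one, one_pow, one_mul]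
  refine Finset.prod_congr rfl fun i hi => ?_
  have : i ≠ 0 := by have := (Finset.mem_Icc.1 hi).1; omega
  rw [if_neg this, Nat.multichoose_eq, add_comm (α (i - 1))]

/-! ### Partial fillings and removal of the largest value. -/

/-- The inversion pairs in the second column with both rows in `U`. -/
def secondColumnPairs (U : Finset ℕ) (e : ℕ × ℕ → ℕ) : Finset (ℕ × ℕ) :=
  {p ∈ U ×ˢ U | e (p.1, 1) < e (p.2, 1) ∧ p.2 < p.1}

/-- The inversion pairs in the first column with both rows in `R`. -/
def firstColumnPairs (R : Finset ℕ) (e : ℕ × ℕ → ℕ) : Finset (ℕ × ℕ) :=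
  {p ∈ R ×ˢ R | e (p.1, 0) < e (p.2, 0) ∧ e (p.2, 1) < e (p.1, 1)}

/-- The boxes to be filled when the rows in `U` are empty and those in `O` lack the first entry. -/
def freeCells (U O : Finset ℕ) : Finset (ℕ × ℕ) :=
  U ×ˢ {1} ∪ (U ∪ O) ×ˢ {0}

/-- `e` extends `ε` to the boxes `C` by the values `1, …, N`, increasingly along the rows. -/
structure IsConfig (C : Finset (ℕ × ℕ)) (ε : ℕ × ℕ → ℕ) (N : ℕ) (e : ℕ × ℕ → ℕ) : Prop where
  eq_off : ∀ x ∉ C, e x = ε x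
  bijOn : Set.BijOn e C (Set.Icc 1 N)
  row_lt : ∀ r, (r, 1) ∈ C → e (r, 0) < e (r, 1)

/-- Moving the largest value into the prescribed part `ε` keeps `e` itself unchanged, so inversions
before and after are compared on one function. -/
theorem IsConfig.erase {C : Finset (ℕ × ℕ)} {ε e : ℕ × ℕ → ℕ} {N : ℕ}
    (h : IsConfig C ε (N + 1) e) {x : ℕ × ℕ} (hx : x ∈ C) (hex : e x = N + 1) :
    IsConfig (C.erase x) (Function.update ε x (N + 1)) N e where
  eq_off y hy := by
    by_cases hyx : y = x
    · subst hyx; simpa using hex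
    · rw [Function.update_of_ne hyx]
      exact h.eq_off y fun hC => hy (Finset.mem_erase.2 ⟨hyx, hC⟩)
  bijOn := by
    refine ⟨fun y hy => ?_, h.bijOn.injOn.mono (by simp), fun v hv => ?_⟩
    · rw [Finset.mem_coe, Finset.mem_erase] at hy
      have h1 := h.bijOn.mapsTo hy.2
      have h2 : e y ≠ N + 1 := fun h3 => hy.1 (h.bijOn.injOn hy.2 hx (h3.trans hex.symm))
      simp only [Set.mem_Icc] at h1 ⊢
      omega
    · simp only [Set.mem_Icc] at hv
      obtain ⟨y, hy, rfl⟩ := h.bijOn.surjOn (show v ∈ Set.Icc 1 (N + 1) by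
        simp only [Set.mem_Icc]; omega)
      refine ⟨y, ?_, rfl⟩
      rw [Finset.mem_coe, Finset.mem_erase]
      refine ⟨?_, hy⟩
      rintro rfl
      omega
  row_lt r hr := h.row_lt r (Finset.mem_of_mem_erase hr)

theorem IsConfig.of_erase {C : Finset (ℕ × ℕ)} {ε e : ℕ × ℕ → ℕ} {N : ℕ} {x : ℕ × ℕ} (hx : x ∈ C)
    (h : IsConfig (C.erase x) (Function.update ε x (N + 1)) N e)
    (hrow : ∀ r, x = (r, 1) → (r, 0) ∈ C) :
    IsConfig C ε (N + 1) e ∧ e x = N + 1 := by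
  have hex : e x = N + 1 := by rw [h.eq_off x (by simp)]; simp
  refine ⟨⟨fun y hy => ?_, ?_, fun r hr => ?_⟩, hex⟩
  · have hyx : y ≠ x := by rintro rfl; exact hy hx
    rw [h.eq_off y (fun h' => hy (Finset.mem_of_mem_erase h')), Function.update_of_ne hyx]
  · have h1 := h.bijOn.insert (a := x) (by rw [hex]; simp)
    have h2 : insert x ((C.erase x : Finset (ℕ × ℕ)) : Set (ℕ × ℕ)) = C := by
      rw [← Finset.coe_insert, Finset.insert_erase hx]
    have h3 : insert (e x) (Set.Icc 1 N) = Set.Icc 1 (N + 1) := by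
      rw [hex]; ext v; simp only [Set.mem_insert_iff, Set.mem_Icc]; omega
    rwa [h2, h3] at h1
  · by_cases hrx : (r, 1) = x
    · have h0 : (r, 0) ∈ C.erase x := by
        rw [Finset.mem_erase]
        exact ⟨by rw [← hrx]; simp, hrow r hrx.symm⟩
      have h1 := h.bijOn.mapsTo h0
      rw [hrx, hex]
      exact Nat.lt_succ_of_le h1.2
    · exact h.row_lt r (Finset.mem_erase.2 ⟨hrx, hr⟩)

theorem freeCells_erase_second {U O : Finset ℕ} {r : ℕ} (hr : r ∈ U) :
    (freeCells U O).erase (r, 1) = freeCells (U.erase r) (insert r O) := by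
  ext ⟨s, c⟩
  simp only [freeCells, mem_erase, mem_union, mem_product, mem_singleton, mem_insert, ne_eq,
    Prod.mk.injEq]
  by_cases h : s = r
  · subst h; simp [hr]; omega
  · simp only [h]; tauto

theorem freeCells_erase_first {U O : Finset ℕ} {r : ℕ} (hr : r ∉ U) :
    (freeCells U O).erase (r, 0) = freeCells U (O.erase r) := by
  ext ⟨s, c⟩
  simp only [freeCells, mem_erase, mem_union, mem_product, mem_singleton, ne_eq, Prod.mk.injEq]
  by_cases h : s = r
  · subst h; simp only [hr]; tauto
  · simp only [h]; tauto

/-- The largest value is either the second entry of an empty row or the first entry of a row that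
lacks only this entry. -/
theorem isConfig_freeCells_succ_iff {U O : Finset ℕ} (hUO : Disjoint U O) {ε e : ℕ × ℕ → ℕ}
    {N : ℕ} :
    IsConfig (freeCells U O) ε (N + 1) e ↔
      (∃ r ∈ U, IsConfig (freeCells (U.erase r) (insert r O))
          (Function.update ε (r, 1) (N + 1)) N e) ∨
        ∃ r ∈ O, IsConfig (freeCells U (O.erase r)) (Function.update ε (r, 0) (N + 1)) N e := by
  constructor
  · intro h
    obtain ⟨⟨r, c⟩, hx, hex⟩ := h.bijOn.surjOn (show N + 1 ∈ Set.Icc 1 (N + 1) by simp)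
    have hx' : r ∈ U ∧ c = 1 ∨ (r ∈ U ∨ r ∈ O) ∧ c = 0 := by
      simpa [freeCells, eq_comm] using hx
    rcases hx' with ⟨hr, rfl⟩ | ⟨hr, rfl⟩
    · exact .inl ⟨r, hr, freeCells_erase_second hr ▸ h.erase hx hex⟩
    · have hrU : r ∉ U := fun hr => by
        have h1 : (r, 1) ∈ freeCells U O := by simp [freeCells, hr]
        have h2 := h.row_lt r h1
        have h3 := (h.bijOn.mapsTo h1).2
        omega
      exact .inr ⟨r, hr.resolve_left hrU, freeCells_erase_first hrU ▸ h.erase hx hex⟩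
  · rintro (⟨r, hr, h⟩ | ⟨r, hr, h⟩)
    · rw [← freeCells_erase_second hr] at h
      refine (IsConfig.of_erase (by simp [freeCells, hr]) h ?_).1
      rintro s hs
      obtain rfl : r = s := by simpa using hs
      simp [freeCells, hr]
    · have hrU : r ∉ U := fun h => Finset.disjoint_left.1 hUO h hr
      rw [← freeCells_erase_first hrU] at h
      refine (IsConfig.of_erase (by simp [freeCells, hr]) h ?_).1
      simp

/-! ### Inversion pairs involving the largest value. -/

theorem card_secondColumnPairs_of_max {U : Finset ℕ} {e : ℕ × ℕ → ℕ} {r : ℕ} (hr : r ∈ U)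
    (hmax : ∀ s ∈ U.erase r, e (s, 1) < e (r, 1)) :
    #(secondColumnPairs U e) = #(secondColumnPairs (U.erase r) e) + #{s ∈ U | r < s} := by
  have hdisj : Disjoint (secondColumnPairs (U.erase r) e)
      ({s ∈ U | r < s} ×ˢ {r}) := by
    rw [Finset.disjoint_left]
    rintro ⟨s, t⟩ h1 h2
    simp [secondColumnPairs] at h1 h2
    omega
  rw [← mul_one #{s ∈ U | r < s}, ← Finset.card_singleton r, ← Finset.card_product,
    ← Finset.card_union_of_disjoint hdisj]
  congr 1
  ext ⟨s, t⟩
  simp only [secondColumnPairs, mem_filter, mem_product, mem_erase, mem_union,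
    mem_singleton] at hmax ⊢
  constructor
  · rintro ⟨⟨hs, ht⟩, h1, h2⟩
    have hsr : s ≠ r := by
      rintro rfl
      have := hmax t ⟨by omega, ht⟩
      omega
    by_cases htr : t = r
    · exact .inr ⟨⟨hs, htr ▸ h2⟩, htr⟩
    · exact .inl ⟨⟨⟨hsr, hs⟩, htr, ht⟩, h1, h2⟩
  · rintro (⟨⟨⟨-, hs⟩, -, ht⟩, h1, h2⟩ | ⟨⟨hs, h1⟩, rfl⟩)
    · exact ⟨⟨hs, ht⟩, h1, h2⟩
    · exact ⟨⟨hs, hr⟩, hmax s ⟨h1.ne', hs⟩, h1⟩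

theorem card_firstColumnPairs_of_max {R : Finset ℕ} {e : ℕ × ℕ → ℕ} {r : ℕ} (hr : r ∈ R)
    (hmax : ∀ s ∈ R.erase r, e (s, 0) < e (r, 0)) :
    #(firstColumnPairs R e) =
      #(firstColumnPairs (R.erase r) e) + #{s ∈ R | e (r, 1) < e (s, 1)} := by
  have hdisj : Disjoint (firstColumnPairs (R.erase r) e)
      ({s ∈ R | e (r, 1) < e (s, 1)} ×ˢ {r}) := by
    rw [Finset.disjoint_left]
    rintro ⟨s, t⟩ h1 h2
    simp [firstColumnPairs] at h1 h2
    omega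
  rw [← mul_one #{s ∈ R | e (r, 1) < e (s, 1)},
    ← congrArg (_ * ·) (Finset.card_singleton r), ← Finset.card_product,
    ← Finset.card_union_of_disjoint hdisj]
  congr 1
  ext ⟨s, t⟩
  simp only [firstColumnPairs, mem_filter, mem_product, mem_erase, mem_union,
    mem_singleton] at hmax ⊢
  constructor
  · rintro ⟨⟨hs, ht⟩, h1, h2⟩
    have hsr : s ≠ r := by
      rintro rfl
      have := hmax t ⟨by rintro rfl; omega, ht⟩
      omega
    by_cases htr : t = r
    · exact .inr ⟨⟨hs, htr ▸ h2⟩, htr⟩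
    · exact .inl ⟨⟨⟨hsr, hs⟩, htr, ht⟩, h1, h2⟩
  · rintro (⟨⟨⟨-, hs⟩, -, ht⟩, h1, h2⟩ | ⟨⟨hs, h1⟩, rfl⟩)
    · exact ⟨⟨hs, ht⟩, h1, h2⟩
    · exact ⟨⟨hs, hr⟩, hmax s ⟨by rintro rfl; omega, hs⟩, h1⟩

/-- The number of inversion pairs among the rows `U` (second column) and `U ∪ O` (first column). -/
def configInv (U O : Finset ℕ) (e : ℕ × ℕ → ℕ) : ℕ :=
  #(secondColumnPairs U e) + #(firstColumnPairs (U ∪ O) e)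

theorem configInv_of_second {U O : Finset ℕ} {ε e : ℕ × ℕ → ℕ} {N r : ℕ} (hr : r ∈ U)
    (h : IsConfig (freeCells (U.erase r) (insert r O))
      (Function.update ε (r, 1) (N + 1)) N e) :
    configInv U O e = #{s ∈ U | r < s} + configInv (U.erase r) (insert r O) e := by
  have her : e (r, 1) = N + 1 := by
    rw [h.eq_off (r, 1) (by simp [freeCells])]; simp
  have hmax : ∀ s ∈ U.erase r, e (s, 1) < e (r, 1) := fun s hs => by
    have := (h.bijOn.mapsTo (show (s, 1) ∈ freeCells (U.erase r) (insert r O) by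
      simpa [freeCells] using hs)).2
    omega
  have hU : U.erase r ∪ insert r O = U ∪ O := by
    rw [Finset.union_insert, ← Finset.insert_union, Finset.insert_erase hr]
  rw [configInv, configInv, card_secondColumnPairs_of_max hr hmax, hU]
  ring

/-- Rows of `U` contribute nothing new: their second entries are at most `N`, while that of row `r`
exceeds `N`. -/
theorem configInv_of_first {U O : Finset ℕ} (hUO : Disjoint U O) {ε e : ℕ × ℕ → ℕ} {N r : ℕ}
    (hr : r ∈ O) (hε : ∀ s ∈ O, N < ε (s, 1))
    (h : IsConfig (freeCells U (O.erase r)) (Function.update ε (r, 0) (N + 1)) N e) :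
    configInv U O e = #{s ∈ O | ε (r, 1) < ε (s, 1)} + configInv U (O.erase r) e := by
  have hrU : r ∉ U := fun h => Finset.disjoint_left.1 hUO h hr
  have her : e (r, 0) = N + 1 := by
    rw [h.eq_off (r, 0) (by simp [freeCells, hrU])]; simp
  have hR : (U ∪ O).erase r = U ∪ O.erase r := by
    rw [Finset.erase_union_distrib, Finset.erase_eq_of_notMem hrU]
  have hO : ∀ s ∈ O, e (s, 1) = ε (s, 1) := fun s hs => by
    rw [h.eq_off (s, 1) (by simp [freeCells, Finset.disjoint_right.1 hUO hs])]
    simp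
  have hmax : ∀ s ∈ (U ∪ O).erase r, e (s, 0) < e (r, 0) := fun s hs => by
    rw [hR] at hs
    have := (h.bijOn.mapsTo (show (s, 0) ∈ freeCells U (O.erase r) by
      simpa [freeCells] using hs)).2
    omega
  have hfilter : {s ∈ U ∪ O | e (r, 1) < e (s, 1)} = {s ∈ O | ε (r, 1) < ε (s, 1)} := by
    ext s
    simp only [mem_filter, mem_union]
    constructor
    · rintro ⟨hs | hs, h1⟩
      · have h2 := (h.bijOn.mapsTo (show (s, 1) ∈ freeCells U (O.erase r) by
          simpa [freeCells] using hs)).2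
        have h3 := hε r hr
        rw [hO r hr] at h1
        omega
      · exact ⟨hs, by rwa [hO r hr, hO s hs] at h1⟩
    · rintro ⟨hs, h1⟩
      exact ⟨.inr hs, by rwa [hO r hr, hO s hs]⟩
  rw [configInv, configInv, card_firstColumnPairs_of_max (by simp [hr]) hmax, hR, hfilter]
  ring

/-! ### The generating function of partial fillings. -/

/-- The generating function of the configurations by inversion pairs. The induction removes the
largest value. -/
theorem exists_finset_isConfig (L N : ℕ) (U O : Finset ℕ) (ε : ℕ × ℕ → ℕ) (hUO : Disjoint U O)
    (hN : N = 2 * #U + #O) (hL : #U + #O ≤ L) (hinj : Set.InjOn (fun r => ε (r, 1)) O)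
    (hε : ∀ r ∈ O, N < ε (r, 1)) :
    ∃ F : Finset (ℕ × ℕ → ℕ), (∀ e, e ∈ F ↔ IsConfig (freeCells U O) ε N e) ∧
      ∑ e ∈ F, (X : ℕ[X]) ^ configInv U O e = configWeight L #U #O := by
  classical
  induction N generalizing U O ε with
  | zero =>
    obtain rfl : U = ∅ := Finset.card_eq_zero.1 (by omega)
    obtain rfl : O = ∅ := Finset.card_eq_zero.1 (by omega)
    refine ⟨{ε}, fun e => ?_, ?_⟩
    · rw [Finset.mem_singleton]
      constructor
      · rintro rfl
        exact ⟨fun _ _ => rfl, by simp [freeCells], by simp [freeCells]⟩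
      · exact fun h => funext fun x => h.eq_off x (by simp [freeCells])
    · simp [configInv, secondColumnPairs, firstColumnPairs, configWeight_zero_zero]
  | succ N ih =>
    -- The membership hypothesis stands inside the existential so that `choose` yields a family
    -- indexed by all of `ℕ`.
    have hU : ∀ r, ∃ F : Finset (ℕ × ℕ → ℕ), r ∈ U →
        (∀ e, e ∈ F ↔ IsConfig (freeCells (U.erase r) (insert r O))
          (Function.update ε (r, 1) (N + 1)) N e) ∧
        ∑ e ∈ F, (X : ℕ[X]) ^ configInv (U.erase r) (insert r O) e =
          configWeight L (#U - 1) (#O + 1) := by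
      intro r
      by_cases hr : r ∈ U
      · have hrO : r ∉ O := Finset.disjoint_left.1 hUO hr
        have hpos : 0 < #U := Finset.card_pos.2 ⟨r, hr⟩
        have hne : ∀ s ∈ O, s ≠ r := fun s hs h => hrO (h ▸ hs)
        have hc := Finset.card_erase_of_mem hr
        have hc' := Finset.card_insert_of_notMem hrO
        have hval : ∀ s ∈ O, Function.update ε (r, 1) (N + 1) (s, 1) = ε (s, 1) := fun s hs => by
          simp [Function.update_of_ne, hne s hs]
        obtain ⟨F, hF⟩ := ih (U.erase r) (insert r O) (Function.update ε (r, 1) (N + 1))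
          (by
            rw [Finset.disjoint_insert_right]
            exact ⟨by simp, hUO.mono_left (Finset.erase_subset _ _)⟩)
          (by omega) (by omega)
          (by
            rw [Finset.coe_insert, Set.injOn_insert (by simpa using hrO)]
            refine ⟨fun s hs t ht h => hinj hs ht ?_, ?_⟩
            · simpa only [hval s hs, hval t ht] using h
            · rintro ⟨s, hs, h⟩
              have := hε s hs
              simp only [hval s hs, Function.update_self] at h
              omega)
          (by
            intro s hs
            rcases Finset.mem_insert.1 hs with rfl | hs
            · simp
            · rw [hval s hs]
              exact (Nat.lt_succ_self N).trans (hε s hs))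
        rw [hc, hc'] at hF
        exact ⟨F, fun _ => hF⟩
      · exact ⟨∅, fun h => absurd h hr⟩
    have hO : ∀ r, ∃ F : Finset (ℕ × ℕ → ℕ), r ∈ O →
        (∀ e, e ∈ F ↔ IsConfig (freeCells U (O.erase r))
          (Function.update ε (r, 0) (N + 1)) N e) ∧
        ∑ e ∈ F, (X : ℕ[X]) ^ configInv U (O.erase r) e = configWeight L #U (#O - 1) := by
      intro r
      by_cases hr : r ∈ O
      · have hpos : 0 < #O := Finset.card_pos.2 ⟨r, hr⟩
        have hc := Finset.card_erase_of_mem hr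
        have hval : ∀ s, Function.update ε (r, 0) (N + 1) (s, 1) = ε (s, 1) := fun s => by
          simp
        obtain ⟨F, hF⟩ := ih U (O.erase r) (Function.update ε (r, 0) (N + 1))
          (hUO.mono_right (Finset.erase_subset _ _)) (by omega) (by omega)
          (by
            simp only [hval]
            exact hinj.mono (by simp))
          (by
            intro s hs
            rw [hval s]
            exact (Nat.lt_succ_self N).trans (hε s (Finset.mem_of_mem_erase hs)))
        rw [hc] at hF
        exact ⟨F, fun _ => hF⟩
      · exact ⟨∅, fun h => absurd h hr⟩
    choose FU hFU using hU
    choose FO hFO using hO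
    have hFUval : ∀ r ∈ U, ∀ e ∈ FU r, IsConfig (freeCells U O) ε (N + 1) e ∧
        e (r, 1) = N + 1 := fun r hr e he => by
      have h := ((hFU r hr).1 e).1 he
      refine ⟨(isConfig_freeCells_succ_iff hUO).2 (.inl ⟨r, hr, h⟩), ?_⟩
      rw [h.eq_off (r, 1) (by simp [freeCells])]
      simp
    have hFOval : ∀ r ∈ O, ∀ e ∈ FO r, IsConfig (freeCells U O) ε (N + 1) e ∧
        e (r, 0) = N + 1 := fun r hr e he => by
      have h := ((hFO r hr).1 e).1 he
      refine ⟨(isConfig_freeCells_succ_iff hUO).2 (.inr ⟨r, hr, h⟩), ?_⟩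
      rw [h.eq_off (r, 0) (by simp [freeCells, Finset.disjoint_right.1 hUO hr])]
      simp
    -- The position of `N + 1` determines the piece containing `e`, whence all three disjointness
    -- claims.
    have hdU : (U : Set ℕ).PairwiseDisjoint FU := by
      intro r hr s hs hrs
      refine Finset.disjoint_left.2 fun e h1 h2 => hrs ?_
      have hr' : r ∈ U := hr
      have hs' : s ∈ U := hs
      have h3 := (hFUval r hr e h1).1.bijOn.injOn
        (show (r, 1) ∈ (freeCells U O : Set _) by simp [freeCells, hr'])
        (show (s, 1) ∈ (freeCells U O : Set _) by simp [freeCells, hs'])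
        ((hFUval r hr e h1).2.trans (hFUval s hs e h2).2.symm)
      exact (Prod.mk.inj h3).1
    have hdO : (O : Set ℕ).PairwiseDisjoint FO := by
      intro r hr s hs hrs
      refine Finset.disjoint_left.2 fun e h1 h2 => hrs ?_
      have hr' : r ∈ O := hr
      have hs' : s ∈ O := hs
      have h3 := (hFOval r hr e h1).1.bijOn.injOn
        (show (r, 0) ∈ (freeCells U O : Set _) by simp [freeCells, hr'])
        (show (s, 0) ∈ (freeCells U O : Set _) by simp [freeCells, hs'])
        ((hFOval r hr e h1).2.trans (hFOval s hs e h2).2.symm)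
      exact (Prod.mk.inj h3).1
    have hdUO : Disjoint (U.biUnion FU) (O.biUnion FO) := by
      refine Finset.disjoint_left.2 fun e h1 h2 => ?_
      obtain ⟨r, hr, h1⟩ := Finset.mem_biUnion.1 h1
      obtain ⟨s, hs, h2⟩ := Finset.mem_biUnion.1 h2
      have h3 := (hFUval r hr e h1).1.bijOn.injOn
        (show (r, 1) ∈ (freeCells U O : Set _) by simp [freeCells, hr])
        (show (s, 0) ∈ (freeCells U O : Set _) by simp [freeCells, hs])
        ((hFUval r hr e h1).2.trans (hFOval s hs e h2).2.symm)
      simp at h3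
    refine ⟨U.biUnion FU ∪ O.biUnion FO, fun e => ?_, ?_⟩
    · rw [isConfig_freeCells_succ_iff hUO, Finset.mem_union, Finset.mem_biUnion,
        Finset.mem_biUnion]
      exact or_congr (exists_congr fun r => and_congr_right fun hr => (hFU r hr).1 e)
        (exists_congr fun r => and_congr_right fun hr => (hFO r hr).1 e)
    · rw [Finset.sum_union hdUO, Finset.sum_biUnion hdU, Finset.sum_biUnion hdO,
        configWeight_rec L #U #O hL (by omega),
        -- Empty rows are ranked by their position, rows of `O` by their second entry.
        ← sum_X_pow_card_larger U id (Function.injective_id.injOn),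
        ← sum_X_pow_card_larger O _ hinj, Finset.sum_mul, Finset.sum_mul]
      congr 1
      · refine Finset.sum_congr rfl fun r hr => ?_
        rw [← (hFU r hr).2, Finset.mul_sum]
        refine Finset.sum_congr rfl fun e he => ?_
        rw [configInv_of_second hr (((hFU r hr).1 e).1 he), pow_add]
        rfl
      · refine Finset.sum_congr rfl fun r hr => ?_
        rw [← (hFO r hr).2, Finset.mul_sum]
        refine Finset.sum_congr rfl fun e he => ?_
        rw [configInv_of_first hUO hr (fun s hs => (Nat.lt_succ_self N).trans (hε s hs))
          (((hFO r hr).1 e).1 he), pow_add]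

/-! ### From tableaux of shape `2^n` to configurations. -/

theorem mem_twoColumnShape {n r c : ℕ} : (r, c) ∈ twoColumnShape n ↔ r < n ∧ c < 2 := by
  rw [twoColumnShape, YoungDiagram.mem_ofRowLens]
  simp

theorem mem_freeCells_range {n : ℕ} {x : ℕ × ℕ} :
    x ∈ freeCells (Finset.range n) ∅ ↔ x ∈ twoColumnShape n := by
  obtain ⟨r, c⟩ := x
  rw [mem_twoColumnShape]
  simp only [freeCells, union_empty, mem_union, mem_product, mem_range, mem_singleton]
  omega

theorem card_twoColumnShape (n : ℕ) : (twoColumnShape n).card = 2 * n := by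
  have h : (twoColumnShape n).cells = Finset.range n ×ˢ Finset.range 2 := by
    ext ⟨r, c⟩
    rw [YoungDiagram.mem_cells, mem_twoColumnShape]
    simp
  rw [YoungDiagram.card, h, Finset.card_product, Finset.card_range, Finset.card_range, mul_comm]

/-- The filling as a function on boxes. -/
def RowStandardFilling.toFun {μ : YoungDiagram} (τ : RowStandardFilling μ) (x : ℕ × ℕ) : ℕ :=
  τ.entry x.1 x.2

theorem RowStandardFilling.toFun_injective {μ : YoungDiagram} :
    Function.Injective (RowStandardFilling.toFun (μ := μ)) := fun τ σ h => by
  ext r c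
  exact congrFun h (r, c)

theorem RowStandardFilling.NoRepeats.isConfig {n : ℕ} {τ : RowStandardFilling (twoColumnShape n)}
    (h : τ.NoRepeats) : IsConfig (freeCells (Finset.range n) ∅) 0 (2 * n) τ.toFun where
  eq_off x hx := τ.zeros _ _ fun h => hx (mem_freeCells_range.2 h)
  bijOn := by
    have hmaps : ∀ x ∈ (twoColumnShape n).cells, τ.toFun x ∈ Finset.Icc 1 (2 * n) := fun x hx =>
      Finset.mem_Icc.2 ⟨τ.pos _ _ hx, card_twoColumnShape n ▸ τ.entry_le _ _⟩
    have hinj : Set.InjOn τ.toFun ((twoColumnShape n).cells : Set (ℕ × ℕ)) := fun x hx y hy hxy =>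
      Prod.ext_iff.2 (h _ _ _ _ hx hy hxy)
    have hC : freeCells (Finset.range n) ∅ = (twoColumnShape n).cells := by
      ext x
      exact mem_freeCells_range
    rw [hC, ← Finset.coe_Icc]
    exact ⟨hmaps, hinj, Finset.surjOn_of_injOn_of_card_le _ hmaps hinj (by
      rw [Nat.card_Icc, ← card_twoColumnShape]; exact le_rfl)⟩
  row_lt r hr := τ.row_strict r 0 1 one_pos (mem_freeCells_range.1 hr)

theorem IsConfig.exists_filling {n : ℕ} {e : ℕ × ℕ → ℕ}
    (h : IsConfig (freeCells (Finset.range n) ∅) 0 (2 * n) e) :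
    ∃ τ : RowStandardFilling (twoColumnShape n), τ.NoRepeats ∧ τ.toFun = e := by
  refine ⟨{ entry := fun r c => e (r, c)
            zeros := fun r c hx => h.eq_off _ fun h' => hx (mem_freeCells_range.1 h')
            pos := fun r c hx => (h.bijOn.mapsTo (mem_freeCells_range.2 hx)).1
            row_strict := ?_
            no_skip := ?_ }, ?_, rfl⟩
  · intro r c₁ c₂ hc hx
    have h1 := mem_twoColumnShape.1 hx
    obtain rfl : c₂ = 1 := by omega
    obtain rfl : c₁ = 0 := by omega
    exact h.row_lt r (mem_freeCells_range.2 hx)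
  · intro r c hx v hv hle
    obtain ⟨⟨s, d⟩, hy, hv'⟩ := h.bijOn.surjOn (show v ∈ Set.Icc 1 (2 * n) from
      ⟨hv, hle.trans (h.bijOn.mapsTo (mem_freeCells_range.2 hx)).2⟩)
    exact ⟨s, d, mem_freeCells_range.1 hy, hv'⟩
  · intro r c s d hx hy hxy
    exact Prod.mk.inj (h.bijOn.injOn (mem_freeCells_range.2 hx) (mem_freeCells_range.2 hy) hxy)

theorem RowStandardFilling.NoRepeats.isInversion_iff {n : ℕ}
    {τ : RowStandardFilling (twoColumnShape n)} (h : τ.NoRepeats) (r s c : ℕ) :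
    τ.IsInversion r s c ↔ (c = 1 ∧ (r, s) ∈ secondColumnPairs (Finset.range n) τ.toFun) ∨
      (c = 0 ∧ (r, s) ∈ firstColumnPairs (Finset.range n) τ.toFun) := by
  simp only [IsInversion, mem_twoColumnShape, secondColumnPairs, firstColumnPairs, mem_filter,
    mem_product, mem_range]
  simp only [toFun]
  constructor
  · rintro ⟨⟨hr, hc⟩, ⟨hs, -⟩, hlt, m, heq, hm⟩
    -- Equal entries one box to the right would be a repetition in two distinct rows.
    have hm0 : m = 0 := by
      by_contra hm0
      obtain ⟨⟨-, hc'⟩, -, he⟩ := heq 1 le_rfl (by omega)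
      obtain rfl := (h _ _ _ _ (mem_twoColumnShape.2 ⟨hr, hc'⟩)
        (mem_twoColumnShape.2 ⟨hs, hc'⟩) he).1
      exact lt_irrefl _ hlt
    subst hm0
    obtain rfl | rfl : c = 0 ∨ c = 1 := by omega
    · refine .inr ⟨rfl, ⟨hr, hs⟩, hlt, ?_⟩
      rcases hm with ⟨h1, -⟩ | ⟨-, -, h1⟩
      · omega
      · exact h1
    · refine .inl ⟨rfl, ⟨hr, hs⟩, hlt, ?_⟩
      omega
  · rintro (⟨rfl, ⟨hr, hs⟩, hlt, h1⟩ | ⟨rfl, ⟨hr, hs⟩, hlt, h1⟩)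
    · exact ⟨⟨hr, by omega⟩, ⟨hs, by omega⟩, hlt, 0, by omega, .inl ⟨by omega, h1⟩⟩
    · exact ⟨⟨hr, by omega⟩, ⟨hs, by omega⟩, hlt, 0, by omega,
        .inr ⟨⟨hr, by omega⟩, ⟨hs, by omega⟩, h1⟩⟩

theorem RowStandardFilling.NoRepeats.inv_eq {n : ℕ}
    {τ : RowStandardFilling (twoColumnShape n)} (h : τ.NoRepeats) :
    τ.inv = configInv (Finset.range n) ∅ τ.toFun := by
  have hinj (c : ℕ) : Function.Injective fun p : ℕ × ℕ => (p.1, p.2, c) := fun p q hpq => by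
    simpa [Prod.ext_iff] using hpq
  have hset : {p : ℕ × ℕ × ℕ | τ.IsInversion p.1 p.2.1 p.2.2} =
      ((secondColumnPairs (Finset.range n) τ.toFun).image (fun p => (p.1, p.2, 1)) ∪
        (firstColumnPairs (Finset.range n) τ.toFun).image (fun p => (p.1, p.2, 0)) : Finset (ℕ × ℕ × ℕ)) := by
    ext ⟨r, s, c⟩
    rw [Set.mem_ofPred_eq, h.isInversion_iff, Finset.mem_coe, Finset.mem_union, Finset.mem_image,
      Finset.mem_image]
    simp only [Prod.mk.injEq, Prod.exists]
    constructor
    · rintro (⟨rfl, h⟩ | ⟨rfl, h⟩)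
      · exact .inl ⟨r, s, h, rfl, rfl, rfl⟩
      · exact .inr ⟨r, s, h, rfl, rfl, rfl⟩
    · rintro (⟨_, _, h, rfl, rfl, rfl⟩ | ⟨_, _, h, rfl, rfl, rfl⟩)
      · exact .inl ⟨rfl, h⟩
      · exact .inr ⟨rfl, h⟩
  have hdisj : Disjoint ((secondColumnPairs (Finset.range n) τ.toFun).image fun p => (p.1, p.2, 1))
      ((firstColumnPairs (Finset.range n) τ.toFun).image fun p => (p.1, p.2, 0)) := by
    rw [Finset.disjoint_left]
    intro p hp hq
    obtain ⟨a, -, rfl⟩ := Finset.mem_image.1 hp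
    obtain ⟨b, -, hb⟩ := Finset.mem_image.1 hq
    simp at hb
  rw [inv, hset, Set.ncard_coe_finset, Finset.card_union_of_disjoint hdisj,
    Finset.card_image_of_injective _ (hinj 1), Finset.card_image_of_injective _ (hinj 0), configInv, Finset.union_empty]

theorem ncard_invertedSYT_twoColumnShape (n k : ℕ) :
    (invertedSYT (twoColumnShape n) k).ncard = (configWeight n n 0).coeff k := by
  obtain ⟨F, hF, hsum⟩ := exists_finset_isConfig n (2 * n) (Finset.range n) ∅ 0
    (Finset.disjoint_empty_right _) (by simp) (by simp) (by simp) (by simp)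
  rw [Finset.card_range, Finset.card_empty] at hsum
  have himage : RowStandardFilling.toFun '' invertedSYT (twoColumnShape n) k =
      ({e ∈ F | k = configInv (Finset.range n) ∅ e} : Finset _) := by
    ext e
    rw [Finset.mem_coe, Finset.mem_filter, hF]
    constructor
    · rintro ⟨τ, ⟨h, rfl⟩, rfl⟩
      exact ⟨h.isConfig, h.inv_eq⟩
    · rintro ⟨he, rfl⟩
      obtain ⟨τ, h, rfl⟩ := he.exists_filling
      exact ⟨τ, ⟨h, h.inv_eq⟩, rfl⟩
  rw [← Set.ncard_image_of_injective _ RowStandardFilling.toFun_injective, himage,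
    Set.ncard_coe_finset, ← hsum, Polynomial.finsetSum_coeff, Finset.card_filter]
  simp only [Polynomial.coeff_X_pow]

end InvertedTableaux

/-- The sum runs over the tuples `(α 0, …, α (n-1))` of natural numbers with sum `n`. Truncated
subtraction matters only for `α i = α (i-1) = 0`, where the binomial coefficient is `1`, in
agreement with `binom(-1, 0) = 1`. -/
theorem mainTheorem9 (n : ℕ) (hn : 1 ≤ n) :
    PowerSeries.mk
        (fun k => (InvertedTableaux.invertedSYT (InvertedTableaux.twoColumnShape n) k).ncard) =
      ((InvertedTableaux.qFactorial n *
          ∑ α ∈ Finset.piAntidiag (Finset.range n) n,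
            ∏ i ∈ Finset.Icc 1 (n - 1),
              (Polynomial.C (Nat.choose (α i + α (i - 1) - 1) (α i)) *
                InvertedTableaux.qInt (i + 1) ^ α i) : Polynomial ℕ) : PowerSeries ℕ) := by
  ext k
  rw [PowerSeries.coeff_mk, InvertedTableaux.ncard_invertedSYT_twoColumnShape,
    InvertedTableaux.configWeight_eq n hn, Polynomial.coeff_coe]
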